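/- Let $(V,E,S,c)$ be a finite directed network: $(V,E)$ is a finite directed graph, $S\subseteq V$ is a set of terminals, and $c:E\to\mathbb Z_{\ge 0}$ is a capacity function. Assume that the network is Eulerian, i.e. for each vertex the total capacity of the edges entering it equals the total capacity of the edges leaving it. Let $\mu:S\times S\to\mathbb R_{\ge 0}$ be a directed metric, i.e. $\mu(s,s)=0$ and $\mu(s,u)\le\mu(s,t)+\mu(t,u)$ for all $s,t,u\in S$ (symmetry is not assumed). A multiflow is a pair $f=(\mathcal P,\lambda)$ of a set $\mathcal P$ of directed paths, each connecting two distinct terminals, and a function $\lambda:\mathcal P\to\mathbb R_{\ge 0}$ such that $\sum\{\lambda(P): P\in\mathcal P,\ e\in P\}\le c(e)$ for all $e\in E$. Its value is $\mathrm{val}(\mu,f)=\sum_{P\in\mathcal P}\mu(s_P,t_P)\lambda(P)$, where $s_P$ and $t_P$ are the start and the end of $P$. Let $S^c,S^r$ be two disjoint copies of $S$ and write $p=(p^c,p^r)$ for $p\in\mathbb R^{S^c\cup S^r}$. Let $Q_\mu$ be the set of (coordinatewise) minimal elements of $\{p\in\mathbb R^{S^c\cup S^r} : p(s^c)+p(t^r)\ge\mu(s,t)\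 (s,t\in S)\}$. Let $p\mapsto\bar p$ be the projection to $\mathbb R^{S^c\cup S^r}/(\mathbf 1,-\mathbf 1)\mathbb R$; the image $\bar Q_\mu$ of $Q_\mu$ is the tropical polytope of $-\mu$. For $s\in S$ let $\mu_s$ be the vector with $\mu_s(t^c)=\mu(t,s)$ and $\mu_s(t^r)=\mu(s,t)$ $(t\in S)$. Let $D_\infty(p,q)=\max\{\|(q^c-p^c)_+\|_\infty,\ \|(p^r-q^r)_+\|_\infty\}$. Then the following maximum and minimum are attained and are equal: $$\max\{\mathrm{val}(\mu,f) : f \text{ a multiflow in } (V,E,S,c)\}=\min\Big\{\sum_{xy\in E}c(xy)\,D_\infty(\rho(x),\rho(y)) : \rho:V\to Q_\mu,\ \overline{\rho(s)}=\overline{\mu_s}\ (s\in S)\Big\}.$$ Moreover, the dual is a location problem on the tropical polytope $\bar Q_\mu$ in the following sense. Let $R\subseteq Q_\mu$ be any balanced section, i.e. $p\mapsto\bar p$ maps $R$ bijectively onto $\bar Q_\mu$, and there are no $p,q\in R$ such that $p^c<q^c$ in every coordinate or $p^r<q^r$ in every coordinate. Then the minimum on the right-hand side is unchanged, and is still attained,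 if $\rho$ is restricted to maps $V\to R$ (with the same condition $\overline{\rho(s)}=\overline{\mu_s}$ for $s\in S$). -/

import Mathlib

/-! ### Directed metrics, the polyhedron `Π_μ`, its minimal points, and the tropical polytope -/

/-- A directed metric on `S`: nonnegative, zero on the diagonal, satisfying the triangle
inequality; no symmetry is required, and distinct points may have distance zero. -/
structure IsDirectedMetric {S : Type*} (μ : S → S → ℝ) : Prop where
  nonneg : ∀ s t, 0 ≤ μ s t
  diag : ∀ s, μ s s = 0
  triangle : ∀ s t u, μ s u ≤ μ s t + μ t u

/-- The space `ℝ^{S^c ∪ S^r}`, where `S^c` and `S^r` are two copies of `S`: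
`Sum.inl s` stands for `s^c` and `Sum.inr s` for `s^r`. -/
abbrev CRSpace (S : Type*) : Type _ := S ⊕ S → ℝ

/-- The part of `p` on the copy `S^c`. -/
def cPart {S : Type*} (p : CRSpace S) : S → ℝ := fun s => p (Sum.inl s)

/-- The part of `p` on the copy `S^r`. -/
def rPart {S : Type*} (p : CRSpace S) : S → ℝ := fun s => p (Sum.inr s)

/-- `Π_μ = {p | p(s^c) + p(t^r) ≥ μ(s,t) for all s, t}`. -/
def polyPi {S : Type*} (μ : S → S → ℝ) : Set (CRSpace S) :=
  {p | ∀ s t, μ s t ≤ cPart p s + rPart p t}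

/-- `Q_μ`: the minimal points of `Π_μ` for the coordinatewise order. -/
def minQ {S : Type*} (μ : S → S → ℝ) : Set (CRSpace S) :=
  {p | Minimal (fun q => q ∈ polyPi μ) p}

/-- The line `(1, -1)ℝ` in `ℝ^{S^c ∪ S^r}`. -/
def lineality (S : Type*) : Submodule ℝ (CRSpace S) :=
  Submodule.span ℝ {Sum.elim (fun _ => (1 : ℝ)) (fun _ => (-1 : ℝ))}

/-- The natural projection `p ↦ p̄` to `ℝ^{S^c ∪ S^r} / (1, -1)ℝ`. -/
def crProj {S : Type*} (p : CRSpace S) : CRSpace S ⧸ lineality S :=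
  (lineality S).mkQ p

/-- The tropical polytope `Q̄_μ`, the projection of `Q_μ`. -/
def tropQ {S : Type*} (μ : S → S → ℝ) : Set (CRSpace S ⧸ lineality S) :=
  crProj '' minQ μ

/-- The point `μ_s`, with `μ_s(t^c) = μ(t,s)` and `μ_s(t^r) = μ(s,t)`. -/
def muPoint {S : Type*} (μ : S → S → ℝ) (s : S) : CRSpace S :=
  Sum.elim (fun t => μ t s) (fun t => μ s t)

/-- `D_∞⁺(p,q) = ‖(q - p)₊‖_∞` on `ℝ^X`, `X` finite. -/
noncomputable def DPlus {X : Type*} [Fintype X] (p q : X → ℝ) : ℝ :=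
  ‖(fun x => max (q x - p x) 0 : X → ℝ)‖

/-- `D_∞(p,q) = max {D_∞⁺(p^c,q^c), D_∞⁺(q^r,p^r)}`. -/
noncomputable def DInf {S : Type*} [Fintype S] (p q : CRSpace S) : ℝ :=
  max (DPlus (cPart p) (cPart q)) (DPlus (rPart q) (rPart p))

/-- `R` is balanced: there are no `p, q ∈ R` with `p^c < q^c` or `p^r < q^r`, where `<` means
strict inequality in every coordinate. -/
def IsBalanced {S : Type*} (R : Set (CRSpace S)) : Prop :=
  ¬ ∃ p ∈ R, ∃ q ∈ R, (∀ s, cPart p s < cPart q s) ∨ (∀ s, rPart p s < rPart q s)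

/-- `R ⊆ Q_μ` is a section: the projection maps `R` bijectively onto `Q̄_μ`. -/
def IsSection {S : Type*} (μ : S → S → ℝ) (R : Set (CRSpace S)) : Prop :=
  R ⊆ minQ μ ∧ Set.BijOn crProj R (tropQ μ)

/-! ### Directed networks and multiflows -/

/-- A network on the vertices `V` and the edges `E` (parallel edges and loops are allowed), with
terminal set `S` and nonnegative integer capacities. -/
structure Network (V E : Type*) where
  tail : E → V
  head : E → V
  S : Finset V
  c : E → ℕ

namespace Network

variable {V E : Type*}

open Classical in
/-- At every vertex, the total capacity entering equals the total capacity leaving. -/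
def IsEulerian [Fintype E] (N : Network V E) : Prop :=
  ∀ x : V, ∑ e with N.head e = x, N.c e = ∑ e with N.tail e = x, N.c e

/-- The list of edges `l` is a directed walk from `x` to `y`. -/
def IsWalk (N : Network V E) : V → List E → V → Prop
  | x, [], y => x = y
  | x, e :: l, y => N.tail e = x ∧ N.IsWalk (N.head e) l y

/-- An `S`-path: a directed path (no vertex is repeated) between distinct terminals. -/
structure SPath (N : Network V E) where
  source : N.S
  target : N.S
  source_ne_target : source ≠ target
  edges : List E
  isWalk : N.IsWalk source edges target
  nodup : ((source : V) :: edges.map N.head).Nodup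

open Classical in
/-- A multiflow: a set of `S`-paths with nonnegative flow values obeying the capacities.
Only the values of `flow` on `paths` matter. A finite graph has finitely many `S`-paths, so
finite sets of paths are all sets of paths. -/
structure Multiflow (N : Network V E) where
  paths : Finset N.SPath
  flow : N.SPath → ℝ
  flow_nonneg : ∀ P ∈ paths, 0 ≤ flow P
  capacity : ∀ e : E, ∑ P ∈ paths with e ∈ P.edges, flow P ≤ (N.c e : ℝ)

/-- The flow-value `val(μ, f)`. -/
def Multiflow.val {N : Network V E} (μ : N.S → N.S → ℝ) (f : N.Multiflow) : ℝ :=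
  ∑ P ∈ f.paths, μ P.source P.target * f.flow P

/-- The set of all costs `∑_{xy ∈ E} c(xy) D_∞(ρ(x), ρ(y))` of maps `ρ : V → R` for which
`ρ(s)` and `μ_s` have the same projection for every terminal `s`. -/
def locationCosts [Fintype E] (N : Network V E) (μ : N.S → N.S → ℝ) (R : Set (CRSpace N.S)) :
    Set ℝ :=
  {v | ∃ ρ : V → CRSpace N.S, (∀ x, ρ x ∈ R) ∧
    (∀ s : N.S, crProj (ρ s) = crProj (muPoint μ s)) ∧
    v = ∑ e : E, (N.c e : ℝ) * DInf (ρ (N.tail e)) (ρ (N.head e))}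

end Network

/-!
The maximum multiflow value and the minimum location cost are compared through edge lengths.

*Linear programming.* There are finitely many `S`-paths, so a maximum multiflow exists by
compactness, and Farkas' lemma (`exists_nonneg_combination_of_forall_nonpos`) gives nonnegative edge
lengths `l` with `∑ c(e) l(e)` at most its value `m` such that every `S`-path from `s` to `t` has
length at least `μ(s, t)` (`Network.exists_isGreatest_val_and_lengths`).

*From lengths to maps.* Let `d` be the shortest-walk distance of `l`, capped by a large constant.
The map `x ↦ (d(·, x), d(x, ·))` takes `V` to `Π_μ` and satisfies `D_∞(ρ(x), ρ(y)) ≤ d(x, y)`. The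
retraction `retractQ` of `Π_μ` onto `Q_μ`, which first lowers the `c`-part and then the `r`-part,
does not increase `D_∞`, and it sends the image of a terminal `s` to `μ_s`. This gives a map into
`Q_μ` of cost at most `m`.

*Weak duality.* The condition on `ρ(s)` fixes it only up to a shift by some `α(s)(1, -1)`, so
`D_∞(ρ(s), ρ(t))` need not be at least `μ(s, t)`. But `φ(p) = min p^c` satisfies
`φ(q) - φ(p) ≤ D_∞(p, q)` and equals `α(s)` at `ρ(s)`; hence the edge lengths
`D_∞(ρ(x), ρ(y)) - (φ(ρ(y)) - φ(ρ(x)))` are nonnegative and dominate `μ` along `S`-paths. In an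
Eulerian network a coboundary has total cost `0` (`Network.IsEulerian.sum_coboundary`), so they
cost as much as `ρ`, and every multiflow has value at most that cost.

*Balanced sections.* Replace a map into `Q_μ` by the map into `R` with the same projection. For
balanced `R` the truncation at `0` in `D_∞` is never active between points of `R`, so each edge cost
increases at most by a coboundary (`DInf_le_add_of_isBalanced`), and the total cost does not
increase.
-/

/-! ### Farkas' lemma and linear programming duality -/

/-- **Farkas' lemma** for finitely many linear functionals on an arbitrary real vector space. -/
lemma exists_nonneg_combination_of_forall_nonpos {W ι : Type*} [AddCommGroup W] [Module ℝ W]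
    (s : Finset ι) (a : ι → W →ₗ[ℝ] ℝ) (b : W →ₗ[ℝ] ℝ)
    (h : ∀ x, (∀ i ∈ s, a i x ≤ 0) → b x ≤ 0) :
    ∃ u : ι → ℝ, (∀ i, 0 ≤ u i) ∧ b = ∑ i ∈ s, u i • a i := by
  classical
  induction s using Finset.induction_on generalizing a b with
  | empty =>
    refine ⟨0, fun _ => le_rfl, ?_⟩
    ext x
    have h₁ := h x (by simp)
    have h₂ := h (-x) (by simp)
    rw [map_neg] at h₂
    simp only [Finset.sum_empty, LinearMap.zero_apply]
    linarith
  | insert j s hj ih =>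
    -- Either `a j` is not needed, or some `x` satisfies all constraints but that of `a j`.
    by_cases hs : ∀ x, (∀ i ∈ s, a i x ≤ 0) → b x ≤ 0
    · obtain ⟨u, hu, hb⟩ := ih a b hs
      refine ⟨fun i => if i = j then 0 else u i, fun i => ?_, ?_⟩
      · dsimp only
        split_ifs
        exacts [le_rfl, hu i]
      · rw [Finset.sum_insert hj, hb]
        simp only [if_true, zero_smul, zero_add]
        refine Finset.sum_congr rfl fun i hi => ?_
        rw [if_neg (ne_of_mem_of_not_mem hi hj)]
    · push Not at hs
      obtain ⟨x, hx, hbx⟩ := hs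
      have hjx : 0 < a j x := by
        by_contra hjx
        refine hbx.not_ge (h x fun i hi => ?_)
        rcases Finset.mem_insert.1 hi with rfl | hi
        exacts [not_lt.1 hjx, hx i hi]
      -- Project all functionals along `x` onto the kernel of `a j`.
      obtain ⟨u, hu, hb⟩ := ih (fun i => a i - (a i x / a j x) • a j) (b - (b x / a j x) • a j)
        (by
          intro y hy
          have key : ∀ g : W →ₗ[ℝ] ℝ,
              (g - (g x / a j x) • a j) y = g (y - (a j y / a j x) • x) := by
            intro g
            simp only [LinearMap.sub_apply, LinearMap.smul_apply, map_sub, map_smul, smul_eq_mul]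
            ring
          rw [key]
          refine h _ fun i hi => ?_
          rcases Finset.mem_insert.1 hi with rfl | hi
          · simp [hjx.ne']
          · rw [← key]
            exact hy i hi)
      refine ⟨fun i => if i = j then (b x - ∑ k ∈ s, u k * a k x) / a j x else u i,
        fun i => ?_, ?_⟩
      · dsimp only
        split_ifs
        · refine div_nonneg (sub_nonneg.2 (le_trans ?_ hbx.le)) hjx.le
          exact Finset.sum_nonpos fun k hk => mul_nonpos_of_nonneg_of_nonpos (hu k) (hx k hk)
        · exact hu i
      · rw [Finset.sum_insert hj]
        dsimp only
        rw [if_pos rfl]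
        have hsum : ∑ i ∈ s, (if i = j then (b x - ∑ k ∈ s, u k * a k x) / a j x else u i) • a i
            = ∑ i ∈ s, u i • a i :=
          Finset.sum_congr rfl fun i hi => by rw [if_neg (ne_of_mem_of_not_mem hi hj)]
        rw [hsum]
        ext y
        have hby := LinearMap.congr_fun hb y
        simp only [LinearMap.sub_apply, LinearMap.smul_apply, smul_eq_mul, LinearMap.sum_apply,
          LinearMap.add_apply, mul_sub, Finset.sum_sub_distrib] at hby ⊢
        have hfac : ∑ i ∈ s, u i * (a i x / a j x * a j y)
            = (∑ i ∈ s, u i * a i x) / a j x * a j y := by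
          rw [Finset.sum_div, Finset.sum_mul]
          exact Finset.sum_congr rfl fun i _ => by ring
        rw [hfac] at hby
        rw [sub_div, sub_mul]
        linarith

/-- If every packing of the rows of a nonnegative matrix without zero rows has value at most `m`,
then some covering has cost at most `m`. -/
lemma exists_covering_of_packing_le {P E : Type*} [Fintype P] [Fintype E] (A : P → E → ℝ)
    (hA : ∀ p e, 0 ≤ A p e) (hA' : ∀ p, ∃ e, 0 < A p e) (c : E → ℝ) (w : P → ℝ) (m : ℝ)
    (h : ∀ f : P → ℝ, (∀ p, 0 ≤ f p) → (∀ e, ∑ p, A p e * f p ≤ c e) → ∑ p, w p * f p ≤ m) :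
    ∃ l : E → ℝ, (∀ e, 0 ≤ l e) ∧ (∀ p, w p ≤ ∑ e, A p e * l e) ∧ ∑ e, c e * l e ≤ m := by
  classical
  -- Homogenize: a pair `(l, t)` with `t > 0` satisfying the system below gives the covering `l / t`.
  let coord : E → ((E → ℝ) × ℝ) →ₗ[ℝ] ℝ := fun e => LinearMap.proj e ∘ₗ LinearMap.fst ℝ _ _
  let t : ((E → ℝ) × ℝ) →ₗ[ℝ] ℝ := LinearMap.snd ℝ _ _
  let a : E ⊕ P ⊕ Unit → ((E → ℝ) × ℝ) →ₗ[ℝ] ℝ :=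
    Sum.elim (fun e => -coord e) (Sum.elim (fun p => w p • t - ∑ e, A p e • coord e)
      (fun _ => ∑ e, c e • coord e - m • t))
  by_cases hx : ∀ x, (∀ i ∈ Finset.univ, a i x ≤ 0) → t x ≤ 0
  · exfalso
    obtain ⟨u, hu, hb⟩ := exists_nonneg_combination_of_forall_nonpos Finset.univ a t hx
    have ht := LinearMap.congr_fun hb (0, 1)
    have hl := fun e => LinearMap.congr_fun hb (Pi.single e 1, 0)
    simp only [Fintype.sum_sum_type, a, t, coord, LinearMap.add_apply, LinearMap.sum_apply,
      LinearMap.smul_apply, LinearMap.sub_apply, LinearMap.neg_apply, LinearMap.comp_apply,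
      LinearMap.proj_apply, LinearMap.fst_apply, LinearMap.snd_apply, Sum.elim_inl, Sum.elim_inr,
      smul_eq_mul, Pi.zero_apply, mul_zero, neg_zero, Finset.sum_const_zero, sub_zero, zero_add,
      mul_one, zero_sub, Finset.univ_unique, Finset.sum_singleton, Pi.single_apply, mul_ite,
      Finset.sum_ite_eq', Finset.mem_univ, if_true, mul_neg,
      Finset.sum_neg_distrib] at ht hl
    set θ := u (Sum.inr (Sum.inr default)) with hθ
    set f : P → ℝ := fun p => u (Sum.inr (Sum.inl p)) with hf
    have hload : ∀ e, ∑ p, A p e * f p ≤ θ * c e := by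
      intro e
      have h₁ := hl e
      have h₂ := hu (Sum.inl e)
      have h₃ : ∑ p, A p e * f p = ∑ p, u (Sum.inr (Sum.inl p)) * A p e :=
        Finset.sum_congr rfl fun p _ => mul_comm _ _
      linarith
    have hval : ∑ p, w p * f p = 1 + θ * m := by
      have h₃ : ∑ p, w p * f p = ∑ p, u (Sum.inr (Sum.inl p)) * w p :=
        Finset.sum_congr rfl fun p _ => mul_comm _ _
      linarith
    rcases (hu (Sum.inr (Sum.inr default))).eq_or_lt with h0 | hpos
    -- If `θ = 0`, the loads are nonpositive, so the packing `f` vanishes, but its value is `1`.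
    · rw [← hθ] at h0
      have hf0 : ∀ p, f p = 0 := by
        intro p
        obtain ⟨e, he⟩ := hA' p
        have h₁ : A p e * f p ≤ ∑ p, A p e * f p :=
          Finset.single_le_sum (f := fun p => A p e * f p)
            (fun q _ => mul_nonneg (hA q e) (hu _)) (Finset.mem_univ p)
        have h₂ := hload e
        rw [← h0, zero_mul] at h₂
        refine le_antisymm ?_ (hu _)
        by_contra hp
        have := mul_pos he (not_le.1 hp)
        linarith
      simp only [hf0, mul_zero, Finset.sum_const_zero, ← h0, zero_mul] at hval
      linarith
    -- If `θ > 0`, the packing `f / θ` has value `m + 1 / θ`.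
    · rw [← hθ] at hpos
      have h₁ := h (fun p => f p / θ) (fun p => div_nonneg (hu _) hpos.le) (fun e => by
        simp only [← mul_div_assoc, ← Finset.sum_div]
        rw [div_le_iff₀ hpos, mul_comm]
        exact hload e)
      simp only [← mul_div_assoc, ← Finset.sum_div] at h₁
      rw [div_le_iff₀ hpos, hval] at h₁
      linarith
  · push Not at hx
    obtain ⟨⟨l, r⟩, hl, hr⟩ := hx
    have hr' : 0 < r := hr
    have h₁ : ∀ e, 0 ≤ l e := fun e => by
      have := hl (Sum.inl e) (Finset.mem_univ _)
      simpa [a, coord] using this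
    have h₂ : ∀ p, w p * r ≤ ∑ e, A p e * l e := fun p => by
      have := hl (Sum.inr (Sum.inl p)) (Finset.mem_univ _)
      simpa [a, coord, t] using this
    have h₃ : ∑ e, c e * l e ≤ m * r := by
      have := hl (Sum.inr (Sum.inr ())) (Finset.mem_univ _)
      simpa [a, coord, t] using this
    refine ⟨fun e => l e / r, fun e => div_nonneg (h₁ e) hr'.le, fun p => ?_, ?_⟩
    · simp only [← mul_div_assoc, ← Finset.sum_div]
      rw [le_div_iff₀ hr']
      exact h₂ p
    · simp only [← mul_div_assoc, ← Finset.sum_div]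
      rwa [div_le_iff₀ hr']

/-! ### The directed distance `D_∞` and the points `μ_s` -/

section Geometry

variable {S : Type*} [Fintype S]

lemma DPlus_le_iff {p q : S → ℝ} {a : ℝ} (ha : 0 ≤ a) :
    DPlus p q ≤ a ↔ ∀ s, q s - p s ≤ a := by
  rw [DPlus, pi_norm_le_iff_of_nonneg ha]
  refine forall_congr' fun s => ?_
  rw [Real.norm_of_nonneg (le_max_right _ _), max_le_iff, and_iff_left ha]

lemma DInf_nonneg (p q : CRSpace S) : 0 ≤ DInf p q :=
  le_max_of_le_left (norm_nonneg _)

lemma DInf_le_iff {p q : CRSpace S} {a : ℝ} (ha : 0 ≤ a) :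
    DInf p q ≤ a ↔ (∀ s, cPart q s - cPart p s ≤ a) ∧ ∀ s, rPart p s - rPart q s ≤ a := by
  rw [DInf, max_le_iff, DPlus_le_iff ha, DPlus_le_iff ha]

lemma cPart_sub_le_DInf (p q : CRSpace S) (s : S) : cPart q s - cPart p s ≤ DInf p q :=
  ((DInf_le_iff (DInf_nonneg p q)).1 le_rfl).1 s

lemma rPart_sub_le_DInf (p q : CRSpace S) (s : S) : rPart p s - rPart q s ≤ DInf p q :=
  ((DInf_le_iff (DInf_nonneg p q)).1 le_rfl).2 s

lemma DInf_self (p : CRSpace S) : DInf p p = 0 :=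
  le_antisymm ((DInf_le_iff le_rfl).2 (by simp)) (DInf_nonneg p p)

lemma DInf_triangle (p q r : CRSpace S) : DInf p r ≤ DInf p q + DInf q r := by
  refine (DInf_le_iff (add_nonneg (DInf_nonneg _ _) (DInf_nonneg _ _))).2
    ⟨fun s => ?_, fun s => ?_⟩
  · linarith [cPart_sub_le_DInf p q s, cPart_sub_le_DInf q r s]
  · linarith [rPart_sub_le_DInf p q s, rPart_sub_le_DInf q r s]

omit [Fintype S] in
lemma exists_shift_of_crProj_eq {p q : CRSpace S} (h : crProj p = crProj q) :
    ∃ α : ℝ, (∀ s, cPart p s = cPart q s + α) ∧ ∀ s, rPart p s = rPart q s - α := by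
  obtain ⟨α, hα⟩ := Submodule.mem_span_singleton.1 ((Submodule.Quotient.eq (lineality S)).1 h)
  refine ⟨α, fun s => ?_, fun s => ?_⟩
  · have := congrFun hα (Sum.inl s)
    simp only [Pi.smul_apply, Sum.elim_inl, smul_eq_mul, Pi.sub_apply] at this
    simp only [cPart]
    linarith
  · have := congrFun hα (Sum.inr s)
    simp only [Pi.smul_apply, Sum.elim_inr, smul_eq_mul, Pi.sub_apply] at this
    simp only [rPart]
    linarith

/-- If `p, q` in a balanced set are the shifts by `α, β` of two points along their fibres, then
`D_∞` has grown by at most the coboundary `β - α`. For arbitrary `p, q` this fails when the right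
side is negative; balancedness provides a coordinate `s` with `p(s^c) ≤ q(s^c)`, which excludes
that. -/
lemma DInf_le_add_of_isBalanced {R : Set (CRSpace S)} (hR : IsBalanced R) {p q p' q' : CRSpace S}
    (hp : p ∈ R) (hq : q ∈ R) {α β : ℝ}
    (hpc : ∀ s, cPart p s = cPart p' s + α) (hpr : ∀ s, rPart p s = rPart p' s - α)
    (hqc : ∀ s, cPart q s = cPart q' s + β) (hqr : ∀ s, rPart q s = rPart q' s - β) :
    DInf p q ≤ DInf p' q' + (β - α) := by
  have hc : ∀ s, cPart q s - cPart p s ≤ DInf p' q' + (β - α) := fun s => by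
    linarith [cPart_sub_le_DInf p' q' s, hpc s, hqc s]
  have h0 : 0 ≤ DInf p' q' + (β - α) := by
    by_contra h
    refine hR ⟨q, hq, p, hp, Or.inl fun s => ?_⟩
    linarith [hc s]
  refine (DInf_le_iff h0).2 ⟨hc, fun s => ?_⟩
  linarith [rPart_sub_le_DInf p' q' s, hpr s, hqr s]

lemma iInf_cPart_sub_le_DInf (p q : CRSpace S) :
    (⨅ s, cPart q s) - (⨅ s, cPart p s) ≤ DInf p q := by
  rcases isEmpty_or_nonempty S with hS | hS
  · simpa [Real.iInf_of_isEmpty] using DInf_nonneg p q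
  · rw [sub_le_comm]
    refine le_ciInf fun s => ?_
    have := ciInf_le (Set.finite_range (cPart q)).bddBelow s
    linarith [cPart_sub_le_DInf p q s]

lemma iInf_cPart_eq_shift {μ : S → S → ℝ} (hμ : IsDirectedMetric μ) {p : CRSpace S} {s : S}
    {α : ℝ} (h : ∀ t, cPart p t = cPart (muPoint μ s) t + α) : ⨅ t, cPart p t = α := by
  have : Nonempty S := ⟨s⟩
  refine le_antisymm ((ciInf_le (Set.finite_range (cPart p)).bddBelow s).trans_eq ?_)
    (le_ciInf fun t => ?_)
  · rw [h, show cPart (muPoint μ s) s = μ s s from rfl, hμ.diag, zero_add]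
  · rw [h]
    exact le_add_of_nonneg_left (hμ.nonneg t s)

/-- Subtracting the coboundary of `p ↦ min p^c` from `D_∞` corrects for the position of
`ρ(s)` on the fibre over `μ̄_s`. -/
lemma le_DInf_sub_of_crProj_eq_muPoint {μ : S → S → ℝ} (hμ : IsDirectedMetric μ)
    {p q : CRSpace S} {s t : S} (hp : crProj p = crProj (muPoint μ s))
    (hq : crProj q = crProj (muPoint μ t)) :
    μ s t ≤ DInf p q - ((⨅ u, cPart q u) - ⨅ u, cPart p u) := by
  obtain ⟨α, hα, -⟩ := exists_shift_of_crProj_eq hp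
  obtain ⟨β, hβ, -⟩ := exists_shift_of_crProj_eq hq
  rw [iInf_cPart_eq_shift hμ hα, iInf_cPart_eq_shift hμ hβ]
  have h := cPart_sub_le_DInf p q s
  rw [hα, hβ, show cPart (muPoint μ s) s = μ s s from rfl, hμ.diag,
    show cPart (muPoint μ t) s = μ s t from rfl] at h
  linarith

/-! ### The nonexpansive retraction of `Π_μ` onto `Q_μ` -/

/-- The retraction of `Π_μ` onto `Q_μ`: lower the `c`-part as far as the `r`-part allows, then
lower the `r`-part as far as the new `c`-part allows. -/
noncomputable def retractQ {S : Type*} (μ : S → S → ℝ) (p : CRSpace S) : CRSpace S :=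
  Sum.elim (fun s => ⨆ t, (μ s t - rPart p t))
    (fun t => ⨆ s, (μ s t - ⨆ t', (μ s t' - rPart p t')))

lemma le_cPart_retractQ (μ : S → S → ℝ) (p : CRSpace S) (s t : S) :
    μ s t - rPart p t ≤ cPart (retractQ μ p) s :=
  le_ciSup (f := fun t => μ s t - rPart p t) (Set.finite_range _).bddAbove t

lemma le_rPart_retractQ (μ : S → S → ℝ) (p : CRSpace S) (s t : S) :
    μ s t - cPart (retractQ μ p) s ≤ rPart (retractQ μ p) t :=
  le_ciSup (f := fun s => μ s t - cPart (retractQ μ p) s) (Set.finite_range _).bddAbove s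

omit [Fintype S] in
lemma cPart_retractQ_le {μ : S → S → ℝ} {p : CRSpace S} {s : S} {a : ℝ}
    (h : ∀ t, μ s t - rPart p t ≤ a) : cPart (retractQ μ p) s ≤ a :=
  have : Nonempty S := ⟨s⟩
  ciSup_le h

omit [Fintype S] in
lemma rPart_retractQ_le {μ : S → S → ℝ} {p : CRSpace S} {t : S} {a : ℝ}
    (h : ∀ s, μ s t - cPart (retractQ μ p) s ≤ a) : rPart (retractQ μ p) t ≤ a :=
  have : Nonempty S := ⟨t⟩
  ciSup_le h

lemma retractQ_mem_polyPi (μ : S → S → ℝ) (p : CRSpace S) : retractQ μ p ∈ polyPi μ :=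
  fun s t => by linarith [le_rPart_retractQ μ p s t]

lemma rPart_retractQ_le_rPart (μ : S → S → ℝ) (p : CRSpace S) (t : S) :
    rPart (retractQ μ p) t ≤ rPart p t :=
  rPart_retractQ_le fun s => by linarith [le_cPart_retractQ μ p s t]

lemma retractQ_mem_minQ (μ : S → S → ℝ) (p : CRSpace S) : retractQ μ p ∈ minQ μ := by
  refine ⟨retractQ_mem_polyPi μ p, fun q hq hqp => ?_⟩
  have hq' : ∀ s t, μ s t ≤ cPart q s + rPart q t := hq
  have hr : ∀ t, rPart q t ≤ rPart (retractQ μ p) t := fun t => hqp (Sum.inr t)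
  have hc : ∀ s, cPart q s ≤ cPart (retractQ μ p) s := fun s => hqp (Sum.inl s)
  rintro (s | t)
  · change cPart (retractQ μ p) s ≤ cPart q s
    exact cPart_retractQ_le fun t => by
      linarith [hq' s t, hr t, rPart_retractQ_le_rPart μ p t]
  · change rPart (retractQ μ p) t ≤ rPart q t
    exact rPart_retractQ_le fun s => by linarith [hq' s t, hc s]

lemma DInf_retractQ_le (μ : S → S → ℝ) (p q : CRSpace S) :
    DInf (retractQ μ p) (retractQ μ q) ≤ DInf p q := by
  have hc : ∀ s, cPart (retractQ μ q) s - cPart (retractQ μ p) s ≤ DInf p q := fun s => by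
    rw [sub_le_iff_le_add']
    exact cPart_retractQ_le fun t => by
      linarith [le_cPart_retractQ μ p s t, rPart_sub_le_DInf p q t]
  refine (DInf_le_iff (DInf_nonneg p q)).2 ⟨hc, fun t => ?_⟩
  rw [sub_le_iff_le_add']
  exact rPart_retractQ_le fun s => by linarith [le_rPart_retractQ μ q s t, hc s]

/-- The retraction sends every point of `Π_μ` both of whose `s`-coordinates vanish to `μ_s`. -/
lemma retractQ_eq_muPoint {μ : S → S → ℝ} (hμ : IsDirectedMetric μ) {p : CRSpace S} {s : S}
    (hp : p ∈ polyPi μ) (hc : cPart p s = 0) (hr : rPart p s = 0) :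
    retractQ μ p = muPoint μ s := by
  have hp' : ∀ s t, μ s t ≤ cPart p s + rPart p t := hp
  have hcs : cPart (retractQ μ p) s ≤ 0 :=
    cPart_retractQ_le fun t => by linarith [hp' s t]
  have hrs : rPart (retractQ μ p) s ≤ 0 := (rPart_retractQ_le_rPart μ p s).trans_eq hr
  have hle : muPoint μ s ≤ retractQ μ p := by
    rintro (t | t)
    · change μ t s ≤ cPart (retractQ μ p) t
      linarith [retractQ_mem_polyPi μ p t s]
    · change μ s t ≤ rPart (retractQ μ p) t
      linarith [retractQ_mem_polyPi μ p s t]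
  exact le_antisymm
    ((retractQ_mem_minQ μ p).2 (fun t u => hμ.triangle t s u) hle) hle

end Geometry

/-! ### Walks, paths and distances -/

namespace Network

variable {V E : Type*} (N : Network V E)

lemma IsWalk.append {N : Network V E} {x y z : V} {l l' : List E} (h : N.IsWalk x l y)
    (h' : N.IsWalk y l' z) : N.IsWalk x (l ++ l') z := by
  induction l generalizing x with
  | nil => exact (show x = y from h) ▸ h'
  | cons e l ih => exact ⟨h.1, ih h.2⟩

/-- A path can be entered at any of its vertices. -/
lemma IsWalk.exists_sublist_of_mem {N : Network V E} {x y z : V} {l : List E}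
    (h : N.IsWalk x l y) (hl : (x :: l.map N.head).Nodup) (hz : z ∈ x :: l.map N.head) :
    ∃ l', l'.Sublist l ∧ N.IsWalk z l' y ∧ (z :: l'.map N.head).Nodup := by
  induction l generalizing x with
  | nil =>
    obtain rfl : z = x := by simpa using hz
    exact ⟨[], List.Sublist.refl _, h, hl⟩
  | cons e l ih =>
    rcases List.mem_cons.1 hz with rfl | hz
    · exact ⟨e :: l, List.Sublist.refl _, h, hl⟩
    · obtain ⟨l', h₁, h₂, h₃⟩ := ih h.2 (List.nodup_cons.1 hl).2 hz
      exact ⟨l', h₁.cons e, h₂, h₃⟩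

/-- Every walk contains a path with the same ends. -/
lemma IsWalk.exists_sublist_nodup {N : Network V E} {x y : V} {l : List E} (h : N.IsWalk x l y) :
    ∃ l', l'.Sublist l ∧ N.IsWalk x l' y ∧ (x :: l'.map N.head).Nodup := by
  induction l generalizing x with
  | nil => exact ⟨[], List.Sublist.refl _, h, by simp⟩
  | cons e l ih =>
    obtain ⟨l', h₁, h₂, h₃⟩ := ih h.2
    by_cases hx : x ∈ N.head e :: l'.map N.head
    · obtain ⟨l'', h₄, h₅, h₆⟩ := h₂.exists_sublist_of_mem h₃ hx
      exact ⟨l'', (h₄.trans h₁).cons e, h₅, h₆⟩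
    · exact ⟨e :: l', h₁.cons_cons e, ⟨h.1, h₂⟩, List.nodup_cons.2 ⟨hx, h₃⟩⟩

/-- The length of a shortest walk from `x` to `y` with respect to the edge lengths `l`, but at
most `K`; the cap keeps the distance finite when `y` cannot be reached from `x`. -/
noncomputable def cappedDist (K : ℝ) (l : E → ℝ) (x y : V) : ℝ :=
  sInf (insert K {v | ∃ w, N.IsWalk x w y ∧ v = (w.map l).sum})

section CappedDist

variable {N} {K : ℝ} {l : E → ℝ}

lemma le_cappedDist {x y : V} {a : ℝ} (hK : a ≤ K)
    (h : ∀ w, N.IsWalk x w y → a ≤ (w.map l).sum) : a ≤ N.cappedDist K l x y := by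
  refine le_csInf (Set.insert_nonempty _ _) ?_
  rintro v (rfl | ⟨w, hw, rfl⟩)
  exacts [hK, h w hw]

lemma list_sum_map_nonneg (hl : ∀ e, 0 ≤ l e) (w : List E) : 0 ≤ (w.map l).sum :=
  List.sum_nonneg (by simpa using fun e _ => hl e)

lemma cappedDist_nonneg (hK : 0 ≤ K) (hl : ∀ e, 0 ≤ l e) (x y : V) :
    0 ≤ N.cappedDist K l x y :=
  le_cappedDist hK fun w _ => list_sum_map_nonneg hl w

lemma bddBelow_walkLengths (hK : 0 ≤ K) (hl : ∀ e, 0 ≤ l e) (x y : V) :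
    BddBelow (insert K {v | ∃ w, N.IsWalk x w y ∧ v = (w.map l).sum}) := by
  refine ⟨0, ?_⟩
  rintro v (rfl | ⟨w, -, rfl⟩)
  exacts [hK, list_sum_map_nonneg hl w]

lemma cappedDist_le_cap (hK : 0 ≤ K) (hl : ∀ e, 0 ≤ l e) (x y : V) :
    N.cappedDist K l x y ≤ K :=
  csInf_le (bddBelow_walkLengths hK hl x y) (Set.mem_insert _ _)

lemma cappedDist_le_of_isWalk (hK : 0 ≤ K) (hl : ∀ e, 0 ≤ l e) {x y : V} {w : List E}
    (hw : N.IsWalk x w y) : N.cappedDist K l x y ≤ (w.map l).sum :=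
  csInf_le (bddBelow_walkLengths hK hl x y) (Set.mem_insert_of_mem _ ⟨w, hw, rfl⟩)

lemma cappedDist_self (hK : 0 ≤ K) (hl : ∀ e, 0 ≤ l e) (x : V) : N.cappedDist K l x x = 0 :=
  le_antisymm (cappedDist_le_of_isWalk hK hl (w := []) rfl) (cappedDist_nonneg hK hl x x)

lemma cappedDist_tail_head_le (hK : 0 ≤ K) (hl : ∀ e, 0 ≤ l e) (e : E) :
    N.cappedDist K l (N.tail e) (N.head e) ≤ l e := by
  simpa using cappedDist_le_of_isWalk (N := N) hK hl (w := [e]) ⟨rfl, rfl⟩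

lemma cappedDist_triangle (hK : 0 ≤ K) (hl : ∀ e, 0 ≤ l e) (x y z : V) :
    N.cappedDist K l x z ≤ N.cappedDist K l x y + N.cappedDist K l y z := by
  have hxz := cappedDist_le_cap (N := N) hK hl x z
  rw [← sub_le_iff_le_add]
  refine le_cappedDist ?_ fun w hw => ?_
  · linarith [cappedDist_nonneg (N := N) hK hl y z]
  · rw [sub_le_comm]
    refine le_cappedDist ?_ fun w' hw' => ?_
    · linarith [list_sum_map_nonneg hl w]
    · have := cappedDist_le_of_isWalk hK hl (hw.append hw')
      rw [List.map_append, List.sum_append] at this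
      linarith

end CappedDist

lemma SPath.edges_nodup {N : Network V E} (P : N.SPath) : P.edges.Nodup :=
  List.Nodup.of_map _ (List.nodup_cons.1 P.nodup).2

lemma SPath.edges_ne_nil {N : Network V E} (P : N.SPath) : P.edges ≠ [] := fun h => by
  have := P.isWalk
  rw [h] at this
  exact P.source_ne_target (Subtype.ext this)

open Classical in
lemma SPath.list_sum_eq [Fintype E] {N : Network V E} (P : N.SPath) (l : E → ℝ) :
    (P.edges.map l).sum = ∑ e, (if e ∈ P.edges then 1 else 0) * l e := by
  rw [← List.sum_toFinset l P.edges_nodup]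
  simp only [ite_mul, one_mul, zero_mul]
  rw [← Finset.sum_filter]
  exact Finset.sum_congr (by ext; simp) fun _ _ => rfl

instance finite_SPath [Finite V] [Finite E] : Finite N.SPath := by
  have := Fintype.ofFinite V
  have hfin : Finite {l : List E | l.length ≤ Fintype.card V} :=
    (List.finite_length_le E (Fintype.card V)).to_subtype
  refine Finite.of_injective (β := N.S × N.S × {l : List E | l.length ≤ Fintype.card V})
    (fun P => (P.source, P.target, ⟨P.edges, ?_⟩)) ?_
  · have := (List.nodup_cons.1 P.nodup).2.length_le_card
    rwa [List.length_map] at this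
  · rintro ⟨s, t, _, l, _, _⟩ ⟨s', t', _, l', _, _⟩ h
    simp only [Prod.mk.injEq, Subtype.mk.injEq] at h
    obtain ⟨rfl, rfl, rfl⟩ := h
    rfl

/-! ### Multiflows and their fractional dual -/

open Classical in
/-- A maximum multiflow exists, and its value is the least cost of nonnegative edge lengths for
which every `S`-path from `s` to `t` has length at least `μ(s, t)`. -/
lemma exists_isGreatest_val_and_lengths [Fintype V] [Fintype E] (μ : N.S → N.S → ℝ) :
    ∃ m : ℝ, IsGreatest (Set.range fun f : N.Multiflow => f.val μ) m ∧
      ∃ l : E → ℝ, (∀ e, 0 ≤ l e) ∧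
        (∀ P : N.SPath, μ P.source P.target ≤ (P.edges.map l).sum) ∧
        ∑ e, (N.c e : ℝ) * l e ≤ m := by
  have := Fintype.ofFinite N.SPath
  let A : N.SPath → E → ℝ := fun P e => if e ∈ P.edges then 1 else 0
  have hA : ∀ P e, 0 ≤ A P e := fun P e => by
    dsimp only [A]
    split_ifs <;> norm_num
  let F : Set (N.SPath → ℝ) :=
    {f | (∀ P, 0 ≤ f P) ∧ ∀ e, ∑ P, A P e * f P ≤ N.c e}
  have hload : ∀ (f : N.SPath → ℝ) e,
      ∑ P, A P e * f P = ∑ P ∈ Finset.univ with e ∈ P.edges, f P := by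
    intro f e
    simp only [A, ite_mul, one_mul, zero_mul]
    rw [← Finset.sum_filter]
  have hclosed : IsClosed F := by
    have h₁ : IsClosed {f : N.SPath → ℝ | ∀ P, 0 ≤ f P} := by
      simp only [Set.ofPred_forall]
      exact isClosed_iInter fun P => isClosed_le continuous_const (continuous_apply P)
    have h₂ : IsClosed {f : N.SPath → ℝ | ∀ e, ∑ P, A P e * f P ≤ N.c e} := by
      simp only [Set.ofPred_forall]
      exact isClosed_iInter fun e => isClosed_le (by fun_prop) continuous_const
    exact h₁.inter h₂
  have hcompact : IsCompact F := by
    refine (isCompact_Icc (a := (0 : N.SPath → ℝ))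
      (b := fun _ => ∑ e, (N.c e : ℝ))).of_isClosed_subset hclosed fun f hf => ⟨hf.1, fun P => ?_⟩
    -- An `S`-path has at least one edge, whose capacity bounds the flow on the path.
    obtain ⟨e, he⟩ := List.exists_mem_of_ne_nil _ P.edges_ne_nil
    calc f P = A P e * f P := by simp [A, he]
      _ ≤ ∑ P, A P e * f P := Finset.single_le_sum (f := fun P => A P e * f P)
          (fun Q _ => mul_nonneg (hA Q e) (hf.1 Q)) (Finset.mem_univ P)
      _ ≤ N.c e := hf.2 e
      _ ≤ ∑ e, (N.c e : ℝ) := Finset.single_le_sum (f := fun e => (N.c e : ℝ))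
          (fun _ _ => Nat.cast_nonneg _) (Finset.mem_univ e)
  obtain ⟨f₀, hf₀, hmax⟩ := hcompact.exists_isMaxOn ⟨0, by simp [F]⟩
    (f := fun f : N.SPath → ℝ => ∑ P, μ P.source P.target * f P)
    (Continuous.continuousOn (by fun_prop))
  refine ⟨∑ P, μ P.source P.target * f₀ P, ⟨?_, ?_⟩, ?_⟩
  · exact ⟨⟨Finset.univ, f₀, fun P _ => hf₀.1 P, fun e => (hload f₀ e).symm.trans_le (hf₀.2 e)⟩, rfl⟩
  · rintro _ ⟨f, rfl⟩
    let g : N.SPath → ℝ := fun P => if P ∈ f.paths then f.flow P else 0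
    have hg : g ∈ F := by
      refine ⟨fun P => ?_, fun e => ?_⟩
      · dsimp only [g]
        split_ifs with h
        exacts [f.flow_nonneg P h, le_rfl]
      · rw [hload]
        refine le_trans (le_of_eq ?_) (f.capacity e)
        simp only [g]
        rw [← Finset.sum_filter, Finset.filter_filter]
        exact Finset.sum_congr (by ext; simp [and_comm]) fun _ _ => rfl
    refine le_trans (le_of_eq ?_) (hmax hg)
    simp only [Multiflow.val, g, mul_ite, mul_zero]
    rw [← Finset.sum_filter]
    exact Finset.sum_congr (by ext; simp) fun _ _ => rfl
  · obtain ⟨l, hl, hcov, hcost⟩ := exists_covering_of_packing_le A hA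
      (fun P => by
        obtain ⟨e, he⟩ := List.exists_mem_of_ne_nil _ P.edges_ne_nil
        exact ⟨e, by simp [A, he]⟩)
      (fun e => (N.c e : ℝ)) (fun P => μ P.source P.target) _
      (fun f hf hfc => hmax (show f ∈ F from ⟨hf, hfc⟩))
    exact ⟨l, hl, fun P => (hcov P).trans_eq (P.list_sum_eq l).symm, hcost⟩

/-! ### Weak duality -/

variable {N}

/-- In an Eulerian network the total cost of a coboundary vanishes. -/
lemma IsEulerian.sum_coboundary [Fintype V] [Fintype E] (hN : N.IsEulerian) (φ : V → ℝ) :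
    ∑ e, (N.c e : ℝ) * (φ (N.head e) - φ (N.tail e)) = 0 := by
  classical
  have hfib : ∀ g : E → V, ∑ e, (N.c e : ℝ) * φ (g e)
      = ∑ x, ((∑ e with g e = x, N.c e : ℕ) : ℝ) * φ x := by
    intro g
    rw [← Finset.sum_fiberwise Finset.univ g]
    refine Finset.sum_congr rfl fun x _ => ?_
    rw [Nat.cast_sum, Finset.sum_mul]
    refine Finset.sum_congr rfl fun e he => ?_
    rw [(Finset.mem_filter.1 he).2]
  simp only [mul_sub, Finset.sum_sub_distrib]
  rw [hfib, hfib, sub_eq_zero]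
  refine Finset.sum_congr rfl fun x _ => ?_
  have := hN x
  congr 2

open Classical in
/-- Edge lengths that dominate `μ` along `S`-paths cost at least the value of any multiflow. -/
lemma Multiflow.val_le_sum [Fintype E] {μ : N.S → N.S → ℝ} (f : N.Multiflow) {l : E → ℝ}
    (hl : ∀ e, 0 ≤ l e) (hP : ∀ P : N.SPath, μ P.source P.target ≤ (P.edges.map l).sum) :
    f.val μ ≤ ∑ e, (N.c e : ℝ) * l e := by
  calc f.val μ ≤ ∑ P ∈ f.paths, (∑ e, (if e ∈ P.edges then 1 else 0) * l e) * f.flow P :=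
        Finset.sum_le_sum fun P hPf => mul_le_mul_of_nonneg_right
          ((hP P).trans_eq (P.list_sum_eq l)) (f.flow_nonneg P hPf)
    _ = ∑ e, (∑ P ∈ f.paths with e ∈ P.edges, f.flow P) * l e := by
        simp only [Finset.sum_mul]
        rw [Finset.sum_comm]
        refine Finset.sum_congr rfl fun e _ => ?_
        rw [Finset.sum_filter]
        refine Finset.sum_congr rfl fun P _ => ?_
        split_ifs <;> ring
    _ ≤ ∑ e, (N.c e : ℝ) * l e :=
        Finset.sum_le_sum fun e _ => mul_le_mul_of_nonneg_right (f.capacity e) (hl e)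

lemma IsWalk.DInf_sub_le {T : Type*} [Fintype T] (ρ : V → CRSpace T) (φ : V → ℝ) {x y : V}
    {w : List E} (hw : N.IsWalk x w y) :
    DInf (ρ x) (ρ y) - (φ y - φ x) ≤ (w.map fun e =>
      DInf (ρ (N.tail e)) (ρ (N.head e)) - (φ (N.head e) - φ (N.tail e))).sum := by
  induction w generalizing x with
  | nil =>
    obtain rfl : x = y := hw
    simp [DInf_self]
  | cons e w ih =>
    obtain ⟨rfl, hw⟩ := hw
    have := ih hw
    have := DInf_triangle (ρ (N.tail e)) (ρ (N.head e)) (ρ y)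
    rw [List.map_cons, List.sum_cons]
    linarith

lemma Multiflow.val_le_of_mem_locationCosts [Fintype V] [Fintype E] (hN : N.IsEulerian)
    {μ : N.S → N.S → ℝ} (hμ : IsDirectedMetric μ) (f : N.Multiflow) {R : Set (CRSpace N.S)} {v : ℝ}
    (hv : v ∈ N.locationCosts μ R) : f.val μ ≤ v := by
  obtain ⟨ρ, -, hρ, rfl⟩ := hv
  let φ : V → ℝ := fun x => ⨅ s, cPart (ρ x) s
  have h := f.val_le_sum (μ := μ)
    (l := fun e => DInf (ρ (N.tail e)) (ρ (N.head e)) - (φ (N.head e) - φ (N.tail e)))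
    (fun e => sub_nonneg.2 (iInf_cPart_sub_le_DInf _ _))
    (fun P => (le_DInf_sub_of_crProj_eq_muPoint hμ (hρ P.source) (hρ P.target)).trans
      (P.isWalk.DInf_sub_le ρ φ))
  simp only [mul_sub _ (DInf _ _), Finset.sum_sub_distrib] at h
  rwa [hN.sum_coboundary φ, sub_zero] at h

/-! ### Maps into `Q_μ` and into balanced sections -/

/-- Edge lengths that dominate `μ` along `S`-paths give a map into `Q_μ` that does not cost more:
record the distances from and to the terminals, and retract. -/
lemma exists_location_le_of_lengths [Fintype V] [Fintype E] {μ : N.S → N.S → ℝ}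
    (hμ : IsDirectedMetric μ) {l : E → ℝ} (hl : ∀ e, 0 ≤ l e)
    (hP : ∀ P : N.SPath, μ P.source P.target ≤ (P.edges.map l).sum) :
    ∃ v ∈ N.locationCosts μ (minQ μ), v ≤ ∑ e, (N.c e : ℝ) * l e := by
  let K : ℝ := ∑ s, ∑ t, μ s t
  have hK : 0 ≤ K := Finset.sum_nonneg fun s _ => Finset.sum_nonneg fun t _ => hμ.nonneg s t
  have hμK : ∀ s t, μ s t ≤ K := fun s t =>
    (Finset.single_le_sum (f := fun t => μ s t) (fun t _ => hμ.nonneg s t)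
      (Finset.mem_univ t)).trans
    (Finset.single_le_sum (f := fun s => ∑ t, μ s t)
      (fun s _ => Finset.sum_nonneg fun t _ => hμ.nonneg s t) (Finset.mem_univ s))
  let d : V → V → ℝ := N.cappedDist K l
  have hμd : ∀ s t : N.S, μ s t ≤ d s t := by
    intro s t
    refine le_cappedDist (hμK s t) fun w hw => ?_
    by_cases hst : s = t
    · rw [hst, hμ.diag]
      exact list_sum_map_nonneg hl w
    · obtain ⟨w', hsub, hw', hnd⟩ := hw.exists_sublist_nodup
      refine (hP ⟨s, t, hst, w', hw', hnd⟩).trans ?_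
      exact (hsub.map l).sum_le_sum (by simpa using fun e _ => hl e)
  let ρ : V → CRSpace N.S := fun x => Sum.elim (fun s => d s x) (fun s => d x s)
  have hρ : ∀ x, ρ x ∈ polyPi μ := fun x s t =>
    (hμd s t).trans (cappedDist_triangle hK hl (s : V) x t)
  have hd : ∀ x y, DInf (ρ x) (ρ y) ≤ d x y := by
    refine fun x y => (DInf_le_iff (cappedDist_nonneg hK hl x y)).2 ⟨fun s => ?_, fun s => ?_⟩
    · exact sub_le_iff_le_add'.2 (cappedDist_triangle hK hl (s : V) x y)
    · exact sub_le_iff_le_add.2 (cappedDist_triangle hK hl x y (s : V))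
  refine ⟨_, ⟨fun x => retractQ μ (ρ x), fun x => retractQ_mem_minQ μ _, fun s => ?_, rfl⟩, ?_⟩
  · exact congrArg crProj (retractQ_eq_muPoint hμ (hρ s) (cappedDist_self hK hl (s : V))
      (cappedDist_self hK hl (s : V)))
  · exact Finset.sum_le_sum fun e _ => mul_le_mul_of_nonneg_left
      (((DInf_retractQ_le μ _ _).trans (hd _ _)).trans (cappedDist_tail_head_le hK hl e))
      (Nat.cast_nonneg _)

/-- Moving a map along the fibres into a balanced section does not increase its cost: the increase
on each edge is bounded by a coboundary, and these cancel in an Eulerian network. -/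
lemma exists_location_le_of_isBalanced [Fintype V] [Fintype E] (hN : N.IsEulerian)
    {μ : N.S → N.S → ℝ} {R : Set (CRSpace N.S)} (hR : IsSection μ R) (hb : IsBalanced R) {v : ℝ}
    (hv : v ∈ N.locationCosts μ (minQ μ)) : ∃ v' ∈ N.locationCosts μ R, v' ≤ v := by
  obtain ⟨ρ, hρ, hρs, rfl⟩ := hv
  choose ρ' hρ'R hρ' using fun x => hR.2.surjOn (Set.mem_image_of_mem crProj (hρ x))
  choose α hαc hαr using fun x => exists_shift_of_crProj_eq (hρ' x)
  refine ⟨_, ⟨ρ', hρ'R, fun s => (hρ' s).trans (hρs s), rfl⟩, ?_⟩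
  calc ∑ e, (N.c e : ℝ) * DInf (ρ' (N.tail e)) (ρ' (N.head e))
      ≤ ∑ e, (N.c e : ℝ) * (DInf (ρ (N.tail e)) (ρ (N.head e))
          + (α (N.head e) - α (N.tail e))) :=
        Finset.sum_le_sum fun e _ => mul_le_mul_of_nonneg_left
          (DInf_le_add_of_isBalanced hb (hρ'R _) (hρ'R _) (hαc _) (hαr _) (hαc _) (hαr _))
          (Nat.cast_nonneg _)
    _ = ∑ e, (N.c e : ℝ) * DInf (ρ (N.tail e)) (ρ (N.head e)) := by
        simp only [mul_add, Finset.sum_add_distrib]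
        rw [hN.sum_coboundary α, add_zero]

end Network

theorem mainTheorem7 {V E : Type*} [Fintype V] [Fintype E] (N : Network V E)
    (hN : N.IsEulerian) (μ : N.S → N.S → ℝ) (hμ : IsDirectedMetric μ) :
    ∃ m : ℝ,
      IsGreatest (Set.range fun f : N.Multiflow => f.val μ) m ∧
      IsLeast (N.locationCosts μ (minQ μ)) m ∧
      ∀ R : Set (CRSpace N.S), IsSection μ R → IsBalanced R →
        IsLeast (N.locationCosts μ R) m := by
  obtain ⟨m, hm, l, hl, hP, hlm⟩ := N.exists_isGreatest_val_and_lengths μ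
  have hlow : ∀ R : Set (CRSpace N.S), m ∈ lowerBounds (N.locationCosts μ R) := by
    intro R v hv
    obtain ⟨f, rfl⟩ := hm.1
    exact f.val_le_of_mem_locationCosts hN hμ hv
  obtain ⟨v, hv, hvl⟩ := Network.exists_location_le_of_lengths hμ hl hP
  obtain rfl : v = m := le_antisymm (hvl.trans hlm) (hlow _ hv)
  refine ⟨v, hm, ⟨hv, hlow _⟩, fun R hR hb => ⟨?_, hlow R⟩⟩
  obtain ⟨v', hv', hle⟩ := Network.exists_location_le_of_isBalanced hN hR hb hv
  obtain rfl : v' = v := le_antisymm hle (hlow R hv')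
  exact hv'
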